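/- Let $R=(r_1,\ldots,r_m)\in\mathbb Z_{>0}^m$, $C=(c_1,\ldots,c_n)\in\mathbb Z_{>0}^n$ and $K=(k_{ij})\in\mathbb Z_{>0}^{m\times n}$. Let $T_K(R,C)$ denote the number of $m\times n$ matrices with nonnegative integer entries $a_{ij}\le k_{ij}$, row sums $r_1,\ldots,r_m$ and column sums $c_1,\ldots,c_n$, and assume that $T_K(R,C)>0$. For $s\ge 1$ let $R^{(s)}\in\mathbb Z_{>0}^{sm}$ be the vector $(sr_1,\ldots,sr_m)$ repeated $s$ times, let $C^{(s)}\in\mathbb Z_{>0}^{sn}$ be the vector $(sc_1,\ldots,sc_n)$ repeated $s$ times, and let $K^{(s)}$ be the $sm\times sn$ matrix consisting of $s\times s$ blocks, each equal to $K$. Put $$G(\mathbf x,\mathbf y)=\prod_{i=1}^m\prod_{j=1}^n\left[1+x_iy_j+(x_iy_j)^2+\cdots+(x_iy_j)^{k_{ij}}\right],\qquad \mathbf x^R=\prod_{i=1}^m x_i^{r_i},\qquad \mathbf y^C=\prod_{j=1}^n y_j^{c_j}.$$ Then $T_{K^{(s)}}(R^{(s)},C^{(s)})>0$ for all $s$,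 the infimum of $G(\mathbf x,\mathbf y)/(\mathbf x^R\mathbf y^C)$ over all $x_1,\ldots,x_m,y_1,\ldots,y_n>0$ is positive, and $$\lim_{s\to\infty}\frac1{s^2}\ln T_{K^{(s)}}(R^{(s)},C^{(s)})=\ln\left(\inf_{x_1,\ldots,x_m,y_1,\ldots,y_n>0}\frac{G(\mathbf x,\mathbf y)}{\mathbf x^R\mathbf y^C}\right).$$ Moreover, as $s\to\infty$ with $R$, $C$, $K$ fixed, $$\frac1{s^2}\ln T_{K^{(s)}}(R^{(s)},C^{(s)})=\ln\left(\inf_{x_1,\ldots,x_m,y_1,\ldots,y_n>0}\frac{G(\mathbf x,\mathbf y)}{\mathbf x^R\mathbf y^C}\right)+O\left(\frac{\ln s}{s}\right).$$ -/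

import Mathlib

/-!
Expanding `G(x, y) / (x^R y^C)` over the `K`-bounded tables `A` and putting `x = e^λ`, `y = e^μ`
gives `∑ A, e^⟨u, d(A)⟩`, where `u = (λ, μ)` and the defect `d(A)` is the excess of the margins of
`A` over `R`, `C`. The terms with `d(A) = 0` show `T_K(R, C) ≤ inf G / (x^R y^C)`. Repeating `u`
along the clones raises the sum to the power `s²`, so `ln T_{K^{(s)}} ≤ s² ln inf G / (x^R y^C)`.

For the lower bound, by the minimax theorem there is a probability distribution `p` on the bounded
tables with mean defect `0` and entropy at least `ln inf G / (x^R y^C)`. Rounding `s p` to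
multiplicities with exact total defect `0` and applying Stirling's formula to the multinomial
coefficient yields `e^(s ln inf - O(ln s))` sequences of `s` tables with total defect `0`. Stacking
`s` such sequences, chosen independently, gives block matrices with the right row sums; their column
sums are right only in total over the clones of each column, but take at most `e^O(s ln s)` values.
Among these, uniform column sums maximize the count: for two columns with the same bounds and given
sum, the possible first columns are the lattice points of a box, and the number of those with
coordinate sum `c` is symmetric and unimodal in `c`, so moving a unit from the larger of two column
sums to the smaller one never decreases the number of tables.
-/

open Filter Topology Asymptotics

/-- The set of contingency tables (matrices of nonnegative integers) with row sums `R` and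
column sums `C`, bounded entrywise by `K`. -/
def boundedTables {ι κ : Type*} [Fintype ι] [Fintype κ]
    (K : Matrix ι κ ℕ) (R : ι → ℕ) (C : κ → ℕ) : Set (Matrix ι κ ℕ) :=
  {A | (∀ i, ∑ j, A i j = R i) ∧ (∀ j, ∑ i, A i j = C j) ∧ ∀ i j, A i j ≤ K i j}

/-- `T_K(R, C)`, the number of `K`-bounded contingency tables with margins `R`, `C`.
The set counted is finite, being bounded entrywise. -/
noncomputable def tableCount {ι κ : Type*} [Fintype ι] [Fintype κ]
    (K : Matrix ι κ ℕ) (R : ι → ℕ) (C : κ → ℕ) : ℕ :=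
  (boundedTables K R C).ncard

/-- The `s`-fold cloning `(sR, sR, …, sR)` of a margin `R`, with `s` repetitions;
`Fin.modNat` sends a position to its position inside its block. -/
def cloneMargin {m : ℕ} (s : ℕ) (R : Fin m → ℕ) : Fin (s * m) → ℕ :=
  fun a => s * R a.modNat

/-- The `s`-fold cloning of a matrix: `s × s` blocks, each equal to `K`. -/
def cloneMatrix {m n : ℕ} (s : ℕ) (K : Matrix (Fin m) (Fin n) ℕ) :
    Matrix (Fin (s * m)) (Fin (s * n)) ℕ :=
  fun a b => K a.modNat b.modNat

/-- `G(x, y) = ∏ᵢ ∏ⱼ (1 + xᵢyⱼ + (xᵢyⱼ)² + ⋯ + (xᵢyⱼ)^{kᵢⱼ})`. -/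
noncomputable def tableGenFun {ι κ : Type*} [Fintype ι] [Fintype κ]
    (K : Matrix ι κ ℕ) (x : ι → ℝ) (y : κ → ℝ) : ℝ :=
  ∏ i, ∏ j, ∑ t ∈ Finset.range (K i j + 1), (x i * y j) ^ t

/-- The infimum of `G(x, y) / (x^R y^C)` over all `x, y` with positive coordinates
(a nonempty set of values, bounded below by `0`). -/
noncomputable def genFunInf {ι κ : Type*} [Fintype ι] [Fintype κ]
    (K : Matrix ι κ ℕ) (R : ι → ℕ) (C : κ → ℕ) : ℝ :=
  sInf {v : ℝ | ∃ (x : ι → ℝ) (y : κ → ℝ), (∀ i, 0 < x i) ∧ (∀ j, 0 < y j) ∧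
    v = tableGenFun K x y / ((∏ i, x i ^ R i) * ∏ j, y j ^ C j)}

open AddMonoidAlgebra
open scoped Finset

/-! ### Exchange of units between columns -/

/-- `N` is symmetric about `U / 2` and does not increase away from `U / 2`, both expressed by the
single requirement that of two arguments the one closer to `U / 2` has the larger value. -/
def SymmUnimodal (U : ℤ) (N : ℤ → ℕ) : Prop :=
  ∀ ⦃x y : ℤ⦄, (2 * x - U).natAbs ≤ (2 * y - U).natAbs → N y ≤ N x

lemma sum_Icc_sub (N : ℤ → ℕ) (c : ℤ) (l h : ℕ) :
    ∑ t ∈ Finset.Icc l h, N (c - t) = ∑ z ∈ Finset.Icc (c - h) (c - l), N z :=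
  Finset.sum_bij' (fun t _ => c - t) (fun z _ => (c - z).toNat)
    (by simp only [Finset.mem_Icc]; omega) (by simp only [Finset.mem_Icc]; omega)
    (by simp only [Finset.mem_Icc]; omega) (by simp only [Finset.mem_Icc]; omega) (by simp)

-- The parts of the two windows outside their intersection are reflections of each other, and the
-- reflection brings the points of one part closer to the centre.
lemma SymmUnimodal.sum_Icc {U : ℤ} {N : ℤ → ℕ} (hN : SymmUnimodal U N) (l h : ℕ) :
    SymmUnimodal (U + (l + h)) fun c => ∑ t ∈ Finset.Icc l h, N (c - t) := by
  intro x y hxy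
  simp only [sum_Icc_sub]
  rw [← Finset.sum_sdiff_le_sum_sdiff]
  calc ∑ z ∈ Finset.Icc (y - h) (y - l) \ Finset.Icc (x - h) (x - l), N z
      ≤ ∑ z ∈ Finset.Icc (y - h) (y - l) \ Finset.Icc (x - h) (x - l), N (x + y - (l + h) - z) :=
        Finset.sum_le_sum fun z hz => hN (by
          simp only [Finset.mem_sdiff, Finset.mem_Icc] at hz; omega)
    _ = ∑ z ∈ Finset.Icc (x - h) (x - l) \ Finset.Icc (y - h) (y - l), N z := by
        refine Finset.sum_bij' (fun z _ => x + y - (l + h) - z) (fun z _ => x + y - (l + h) - z)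
          ?_ ?_ ?_ ?_ ?_ <;> simp only [Finset.mem_sdiff, Finset.mem_Icc] <;> intros <;> grind

lemma symmUnimodal_coeff_prod_sum_single {σ : Type*} (l h : σ → ℕ) (s : Finset σ) :
    SymmUnimodal (∑ i ∈ s, ((l i : ℤ) + h i)) fun c =>
      (∏ i ∈ s, ∑ t ∈ Finset.Icc (l i) (h i), (single (t : ℤ) 1 : ℕ[ℤ])).coeff c := by
  classical
  induction s using Finset.induction_on with
  | empty =>
    intro x y hxy
    simp only [Finset.sum_empty, Finset.prod_empty, one_def, coeff_single,
      Finsupp.single_apply] at hxy ⊢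
    split_ifs <;> omega
  | insert a s ha ih =>
    have hstep := ih.sum_Icc (l a) (h a)
    rw [Finset.sum_insert ha, add_comm]
    convert hstep using 2 with c
    rw [Finset.prod_insert ha, Finset.sum_mul, coeff_sum, Finsupp.finsetSum_apply]
    refine Finset.sum_congr rfl fun t _ => ?_
    rw [coeff_single_mul_eq_mul_coeff (c - t) fun m _ => by omega, one_mul]

lemma symmUnimodal_card_Icc_filter_sum {σ : Type*} [Fintype σ] [DecidableEq σ] (l h : σ → ℕ) :
    SymmUnimodal (∑ i, ((l i : ℤ) + h i)) fun c =>
      #{a ∈ Finset.Icc l h | ((∑ i, a i : ℕ) : ℤ) = c} := by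
  convert symmUnimodal_coeff_prod_sum_single l h Finset.univ using 2 with c
  rw [Finset.prod_univ_sum, coeff_sum, Finsupp.finsetSum_apply, Finset.card_filter]
  refine Finset.sum_congr rfl fun a _ => ?_
  rw [prod_single, Finset.prod_const_one, coeff_single, Finsupp.single_apply, Nat.cast_sum]

lemma exists_lt_and_gt_of_sum_fiber_eq {κ γ : Type*} [Fintype κ] [DecidableEq γ] (g : κ → γ)
    {C D : κ → ℕ} (hne : C ≠ D) (hCD : ∀ q, ∑ j with g j = q, C j = ∑ j with g j = q, D j) :
    ∃ j₁ j₂, g j₁ = g j₂ ∧ D j₁ < C j₁ ∧ C j₂ < D j₂ := by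
  obtain ⟨j, hj⟩ := Function.ne_iff.1 hne
  have exists_lt {E F : κ → ℕ} (h : ∑ i with g i = g j, E i = ∑ i with g i = g j, F i)
      (hEF : E j ≠ F j) : ∃ i, g i = g j ∧ F i < E i := by
    by_contra! hle
    exact hEF ((Finset.sum_eq_sum_iff_of_le fun i hi => hle i (by simpa using hi)).1 h j (by simp))
  obtain ⟨j₁, hj₁, h₁⟩ := exists_lt (hCD (g j)) hj
  obtain ⟨j₂, hj₂, h₂⟩ := exists_lt (hCD (g j)).symm hj.symm
  exact ⟨j₁, j₂, hj₁.trans hj₂.symm, h₁, h₂⟩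

section Columns

variable {ι κ : Type*} [Fintype ι] [Fintype κ] [DecidableEq ι]

/-- The generating function of the columns of sum `c` bounded entrywise by `k`. -/
noncomputable def columnGenFun (k : ι → ℕ) (c : ℕ) : ℕ[ι → ℕ] :=
  ∑ a ∈ Finset.Iic k with ∑ i, a i = c, single a 1

lemma coeff_columnGenFun_mul (k u : ι → ℕ) (c c' : ℕ) :
    (columnGenFun k c * columnGenFun k c').coeff u
      = if ∑ i, u i = c + c' then #{a ∈ Finset.Icc (u - k) (k ⊓ u) | ∑ i, a i = c} else 0 := by
  have hcard : (columnGenFun k c * columnGenFun k c').coeff u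
      = #{p ∈ {a ∈ Finset.Iic k | ∑ i, a i = c} ×ˢ {a ∈ Finset.Iic k | ∑ i, a i = c'} |
          p.1 + p.2 = u} := by
    simp only [columnGenFun, Finset.sum_mul_sum, ← Finset.sum_product', single_mul_single, mul_one,
      coeff_sum, Finsupp.finsetSum_apply, coeff_single, Finsupp.single_apply, Finset.card_filter]
  rw [hcard]
  split_ifs with hu
  · refine Finset.card_bij' (fun p _ => p.1) (fun a _ => (a, u - a)) ?_ ?_ ?_ ?_
    · rintro ⟨a, b⟩ h
      simp only [Finset.mem_filter, Finset.mem_product, Finset.mem_Iic] at h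
      obtain ⟨⟨⟨ha, hac⟩, hb, -⟩, rfl⟩ := h
      simp only [Finset.mem_filter, Finset.mem_Icc, le_inf_iff, tsub_le_iff_right]
      exact ⟨⟨add_le_add_right hb a, ha, le_self_add⟩, hac⟩
    · intro a h
      simp only [Finset.mem_filter, Finset.mem_Icc, le_inf_iff, tsub_le_iff_left] at h
      obtain ⟨⟨hlow, hk, hau⟩, hac⟩ := h
      have hsum : ∑ i, a i + ∑ i, (u - a) i = ∑ i, u i := by
        rw [← Finset.sum_add_distrib]
        exact Finset.sum_congr rfl fun i _ => Nat.add_sub_cancel' (hau i)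
      simp only [Finset.mem_filter, Finset.mem_product, Finset.mem_Iic, tsub_le_iff_left]
      exact ⟨⟨⟨hk, hac⟩, by rwa [add_comm], by omega⟩, add_tsub_cancel_of_le hau⟩
    · rintro ⟨a, b⟩ h
      simp only [Finset.mem_filter] at h
      simp [← h.2]
    · exact fun a _ => rfl
  · rw [Finset.card_eq_zero, Finset.filter_eq_empty_iff]
    rintro ⟨a, b⟩ h rfl
    simp only [Finset.mem_filter, Finset.mem_product] at h
    exact hu (by simp only [Pi.add_apply, Finset.sum_add_distrib, h.1.2, h.2.2])

-- The splittings `u = a + b` into two columns form a box in `a`, whose centre is `u / 2`.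
lemma coeff_columnGenFun_mul_le (k : ι → ℕ) {c c' : ℕ} (h : c' ≤ c) (u : ι → ℕ) :
    (columnGenFun k (c + 1) * columnGenFun k c').coeff u
      ≤ (columnGenFun k c * columnGenFun k (c' + 1)).coeff u := by
  simp only [coeff_columnGenFun_mul, show c + (c' + 1) = c + 1 + c' by ring]
  split_ifs with hu
  · by_cases hbox : ∀ i, u i ≤ 2 * k i
    · have hcentre : ∑ i, (((u - k) i : ℤ) + (k ⊓ u) i) = c + 1 + c' := by
        rw [← Nat.cast_add_one, ← Nat.cast_add, ← hu, Nat.cast_sum]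
        refine Finset.sum_congr rfl fun i _ => ?_
        have := hbox i
        simp only [Pi.sub_apply, Pi.inf_apply]
        omega
      simpa only [← Nat.cast_add_one, Nat.cast_inj] using
        symmUnimodal_card_Icc_filter_sum (u - k) (k ⊓ u) (x := c) (y := c + 1) (by omega)
    · obtain ⟨i, hi⟩ := not_forall.1 hbox
      rw [Finset.Icc_eq_empty fun hle => hi (by have := hle i; simp at this; omega)]
      simp
  · rfl

lemma mul_coeff_le_mul_coeff {M : Type*} [AddMonoid M] {f g : ℕ[M]} (h : f.coeff ≤ g.coeff)
    (p : ℕ[M]) : (f * p).coeff ≤ (g * p).coeff := by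
  obtain ⟨d, hd⟩ := exists_add_of_le h
  obtain rfl : g = f + ofCoeff d := coeff_injective (by rw [hd, coeff_add])
  rw [add_mul, coeff_add]
  exact le_self_add

lemma tableCount_eq_coeff_prod (K : Matrix ι κ ℕ) (R : ι → ℕ) (C : κ → ℕ) :
    tableCount K R C = (∏ j, columnGenFun (fun i => K i j) (C j)).coeff R := by
  classical
  simp only [columnGenFun]
  rw [Finset.prod_univ_sum, coeff_sum, Finsupp.finsetSum_apply]
  simp only [prod_single, Finset.prod_const_one, coeff_single, Finsupp.single_apply]
  rw [← Finset.card_filter, ← Set.ncard_coe_finset]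
  refine Set.ncard_congr (fun A _ j i => A i j) ?_ ?_ ?_
  · rintro A ⟨hR, hC, hK⟩
    simp [Pi.le_def, funext_iff, hR, hC, hK]
  · exact fun A B _ _ h => Matrix.transpose_injective h
  · intro B hB
    simp only [Finset.coe_filter, Fintype.mem_piFinset, Finset.mem_filter, Finset.mem_Iic,
      Pi.le_def, Set.mem_ofPred_eq, funext_iff, Finset.sum_apply] at hB
    exact ⟨fun i j => B j i, ⟨hB.2, fun j => (hB.1 j).2, fun i j => (hB.1 j).1 i⟩, rfl⟩

end Columns

section Exchange

variable {ι κ : Type*} [Fintype ι] [Fintype κ]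

lemma tableCount_le_of_add_single [DecidableEq κ] (K : Matrix ι κ ℕ) (R : ι → ℕ) {C C' : κ → ℕ}
    {j₁ j₂ : κ} (hK : ∀ i, K i j₁ = K i j₂) (hlt : C j₂ < C j₁)
    (hC : C' + Pi.single j₁ 1 = C + Pi.single j₂ 1) :
    tableCount K R C ≤ tableCount K R C' := by
  have hne : j₁ ≠ j₂ := by rintro rfl; exact hlt.false
  classical
  have h₁ : C j₁ = C' j₁ + 1 := by simpa [hne] using (congrFun hC j₁).symm
  have h₂ : C' j₂ = C j₂ + 1 := by simpa [hne.symm] using congrFun hC j₂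
  have hsplit (D : κ → ℕ) : ∏ j, columnGenFun (fun i => K i j) (D j)
      = columnGenFun (fun i => K i j₂) (D j₁) * columnGenFun (fun i => K i j₂) (D j₂)
        * ∏ j ∈ (Finset.univ.erase j₁).erase j₂, columnGenFun (fun i => K i j) (D j) := by
    rw [← Finset.mul_prod_erase _ _ (Finset.mem_univ j₁),
      ← Finset.mul_prod_erase _ _ (Finset.mem_erase.2 ⟨hne.symm, Finset.mem_univ j₂⟩), mul_assoc]
    simp only [hK]
  have hrest : ∏ j ∈ (Finset.univ.erase j₁).erase j₂, columnGenFun (fun i => K i j) (C j)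
      = ∏ j ∈ (Finset.univ.erase j₁).erase j₂, columnGenFun (fun i => K i j) (C' j) := by
    refine Finset.prod_congr rfl fun j hj => ?_
    obtain ⟨hj₂, hj₁, -⟩ : j ≠ j₂ ∧ j ≠ j₁ ∧ True := by simpa using hj
    rw [show C j = C' j by simpa [hj₁, hj₂] using (congrFun hC j).symm]
  rw [tableCount_eq_coeff_prod, tableCount_eq_coeff_prod, hsplit, hsplit, hrest, h₁, h₂]
  exact mul_coeff_le_mul_coeff (coeff_columnGenFun_mul_le _ (by omega)) _ R

-- Moving units from columns that are too large to columns that are too small never decreases the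
-- count.
lemma tableCount_le_of_const_on_fibers {γ : Type*} [DecidableEq γ] (g : κ → γ) (K : Matrix ι κ ℕ)
    (R : ι → ℕ) {D : κ → ℕ} (hK : ∀ j₁ j₂, g j₁ = g j₂ → ∀ i, K i j₁ = K i j₂)
    (hD : ∀ j₁ j₂, g j₁ = g j₂ → D j₁ = D j₂) (C : κ → ℕ)
    (hCD : ∀ q, ∑ j with g j = q, C j = ∑ j with g j = q, D j) :
    tableCount K R C ≤ tableCount K R D := by
  classical
  induction hN : ∑ j, (C j - D j) using Nat.strong_induction_on generalizing C with
  | _ N ih =>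
    subst hN
    rcases eq_or_ne C D with rfl | hne
    · rfl
    obtain ⟨j₁, j₂, hg, h₁, h₂⟩ := exists_lt_and_gt_of_sum_fiber_eq g hne hCD
    have hD₁₂ := hD j₁ j₂ hg
    obtain ⟨C', hC'⟩ : ∃ C', C' + Pi.single j₁ 1 = C + Pi.single j₂ 1 := by
      refine ⟨C + Pi.single j₂ 1 - Pi.single j₁ 1, tsub_add_cancel_of_le (le_add_right fun j => ?_)⟩
      rcases eq_or_ne j j₁ with rfl | hj
      · simp only [Pi.single_eq_same]
        omega
      · simp [hj]
    have hC'_apply (j : κ) : C' j + (if j = j₁ then 1 else 0) = C j + if j = j₂ then 1 else 0 := by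
      simpa only [Pi.add_apply, Pi.single_apply] using congrFun hC' j
    refine (tableCount_le_of_add_single K R (hK j₁ j₂ hg) (by omega) hC').trans (ih _ ?_ C' ?_ rfl)
    · exact Finset.sum_lt_sum (fun j _ => by grind) ⟨j₁, Finset.mem_univ _, by grind⟩
    · intro q
      have hsum := Finset.sum_congr (rfl : Finset.univ.filter (g · = q) = _) fun j _ => hC'_apply j
      simp only [Finset.sum_add_distrib, Finset.sum_ite_eq', Finset.mem_filter_univ, hg] at hsum
      rw [← hCD q]
      exact Nat.add_right_cancel hsum

end Exchange

/-! ### Maximum entropy and counting words -/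

-- Sion's theorem only needs one of the two variables to range over a compact set.
lemma exists_forall_le_of_isCompact {E F : Type*} [TopologicalSpace E] [AddCommGroup E] [Module ℝ E]
    [IsTopologicalAddGroup E] [ContinuousSMul ℝ E] [TopologicalSpace F] [AddCommGroup F]
    [Module ℝ F] [IsTopologicalAddGroup F] [ContinuousSMul ℝ F] {X : Set E} {f : E → F → ℝ} {t : ℝ}
    (hX : IsCompact X) (hXne : X.Nonempty)
    (hf_left : ∀ u, Continuous (f · u)) (hconvex : ∀ u, ConvexOn ℝ X (f · u))
    (hf_right : ∀ p, Continuous (f p)) (hconcave : ∀ p, ConcaveOn ℝ Set.univ (f p))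
    (h : ∀ u, ∃ p ∈ X, f p u ≤ t) : ∃ p ∈ X, ∀ u, f p u ≤ t := by
  have hfinite (s : Finset F) : (X ∩ ⋂ u ∈ s, {p | f p u ≤ t}).Nonempty := by
    by_contra! hs
    obtain ⟨u, -, hu⟩ := Sion.exists_lt_iInf_of_lt_iInf_of_finite hXne hX
      (fun u _ => (hf_left u).lowerSemicontinuous.lowerSemicontinuousOn _)
      (fun u _ => (hconvex u).quasiconvexOn) convex_univ
      (fun p _ => (hf_right p).upperSemicontinuous.upperSemicontinuousOn _)
      (fun p _ => (hconcave p).quasiconcaveOn) (hconvex 0).1 s.finite_toSet (Set.subset_univ _)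
      (t := t) fun p hp => by
        by_contra! hle
        exact Set.eq_empty_iff_forall_notMem.1 hs p ⟨hp, Set.mem_iInter₂.2 hle⟩
    obtain ⟨p, hp, hpt⟩ := h u
    exact (hu p hp).not_ge hpt
  obtain ⟨p, hp, hpt⟩ := hX.inter_iInter_nonempty _
    (fun u => isClosed_le (hf_left u) continuous_const) hfinite
  exact ⟨p, hp, fun u => Set.mem_iInter.1 hpt u⟩

section MaximumEntropy

variable {A ι : Type*} [Fintype A] [Fintype ι]

lemma exists_mem_stdSimplex_sum_negMulLog_add_eq_log_sum_exp [Nonempty A] (e : A → ℝ) :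
    ∃ p ∈ stdSimplex ℝ A,
      ∑ a, (p a).negMulLog + ∑ a, p a * e a = Real.log (∑ a, Real.exp (e a)) := by
  set Z := ∑ a, Real.exp (e a)
  have hZ : 0 < Z := Finset.sum_pos (fun a _ => Real.exp_pos _) Finset.univ_nonempty
  have hsum : ∑ a, Real.exp (e a) / Z = 1 := by rw [← Finset.sum_div, div_self hZ.ne']
  refine ⟨fun a => Real.exp (e a) / Z, ⟨fun a => by positivity, hsum⟩, ?_⟩
  have hterm (a : A) : (Real.exp (e a) / Z).negMulLog + Real.exp (e a) / Z * e a
      = Real.exp (e a) / Z * Real.log Z := by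
    rw [Real.negMulLog, Real.log_div (Real.exp_ne_zero _) hZ.ne', Real.log_exp]
    ring
  simp only [← Finset.sum_add_distrib, hterm, ← Finset.sum_mul, hsum, one_mul]

lemma concaveOn_sum_negMulLog : ConcaveOn ℝ (stdSimplex ℝ A) fun p => ∑ a, (p a).negMulLog := by
  have (s : Finset A) : ConcaveOn ℝ (stdSimplex ℝ A) fun p => ∑ a ∈ s, (p a).negMulLog := by
    classical
    induction s using Finset.induction_on with
    | empty => simpa using concaveOn_const 0 (convex_stdSimplex ℝ A)
    | insert a s ha ih =>
      simp only [Finset.sum_insert ha]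
      refine ConcaveOn.add ?_ ih
      exact (Real.concaveOn_negMulLog.comp_linearMap (LinearMap.proj a)).subset
        (fun p hp => hp.1 a) (convex_stdSimplex ℝ A)
  exact this _

lemma exists_mem_stdSimplex_le_sum_negMulLog [Nonempty A] (v : A → ι → ℝ) {L : ℝ}
    (hL : ∀ u : ι → ℝ, L ≤ Real.log (∑ a, Real.exp (u ⬝ᵥ v a))) :
    ∃ p ∈ stdSimplex ℝ A, L ≤ ∑ a, (p a).negMulLog ∧ ∑ a, p a • v a = 0 := by
  obtain ⟨p, hp, hu⟩ : ∃ p ∈ stdSimplex ℝ A, ∀ u : ι → ℝ,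
      -(∑ a, (p a).negMulLog) + -(u ⬝ᵥ ∑ a, p a • v a) ≤ -L := by
    refine exists_forall_le_of_isCompact (isCompact_stdSimplex ℝ A)
      (Set.nonempty_coe_sort.1 inferInstance) (fun u => ?_) (fun u => ?_) (fun p => ?_)
      (fun p => ?_) fun u => ?_
    · fun_prop
    · exact concaveOn_sum_negMulLog.neg.add
        ((-(dotProductBilin ℝ ℝ u ∘ₗ Fintype.linearCombination ℝ v)).convexOn
          (convex_stdSimplex ℝ A))
    · fun_prop
    · exact (concaveOn_const _ convex_univ).add
        ((-((dotProductBilin ℝ ℝ).flip (∑ a, p a • v a))).concaveOn convex_univ)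
    · obtain ⟨p, hp, hpL⟩ := exists_mem_stdSimplex_sum_negMulLog_add_eq_log_sum_exp
        fun a => u ⬝ᵥ v a
      refine ⟨p, hp, ?_⟩
      have := hL u
      simp only [dotProduct_sum, dotProduct_smul, smul_eq_mul]
      linarith
  refine ⟨p, hp, by simpa using hu 0, ?_⟩
  set E := ∑ a, p a • v a
  by_contra hne
  have := hu (((L - ∑ a, (p a).negMulLog - 1) / (E ⬝ᵥ E)) • E)
  rw [smul_dotProduct, smul_eq_mul, div_mul_cancel₀ _ (by simpa using hne)] at this
  linarith

end MaximumEntropy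

lemma prod_single_one_pow {A : Type*} [Fintype A] [DecidableEq A] (k : A → ℕ) :
    ∏ a, (single (Pi.single a 1) 1 : ℕ[A → ℕ]) ^ k a = single k 1 := by
  simp only [single_pow, one_pow, prod_single, Finset.prod_const_one]
  congr 1
  ext a
  simp [Finset.sum_apply, Pi.single_apply]

section Multinomial

variable {X A : Type*} [Fintype X] [Fintype A] [DecidableEq A]

-- Compare the coefficients of `n` in the two expansions of `(∑ a, single (Pi.single a 1) 1) ^ |X|`.
lemma card_filter_fiber_card_eq_multinomial [DecidableEq X] {n : A → ℕ}
    (hn : ∑ a, n a = Fintype.card X) :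
    #{f : X → A | ∀ a, #{x | f x = a} = n a} = Nat.multinomial Finset.univ n := by
  have hexpand : ∑ f : X → A, (single (∑ x, Pi.single (f x) 1) 1 : ℕ[A → ℕ])
      = ∑ k ∈ Finset.piAntidiag Finset.univ (Fintype.card X),
        single k (Nat.multinomial Finset.univ k) := by
    trans (∑ a, (single (Pi.single a 1) 1 : ℕ[A → ℕ])) ^ Fintype.card X
    · rw [← Finset.card_univ, ← Finset.prod_const, Finset.prod_univ_sum, Fintype.piFinset_univ]
      simp only [prod_single, Finset.prod_const_one]
    · rw [Finset.sum_pow_eq_sum_piAntidiag]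
      refine Finset.sum_congr rfl fun k _ => ?_
      rw [prod_single_one_pow, ← nsmul_eq_mul, smul_single, nsmul_eq_mul, Nat.cast_id, mul_one]
  have hcoeff := congrArg (fun F => F.coeff n) hexpand
  simp only [coeff_sum, Finsupp.finsetSum_apply, coeff_single, Finsupp.single_apply,
    ← Finset.card_filter] at hcoeff
  rw [Finset.sum_ite_eq', if_pos (by simpa using hn)] at hcoeff
  simpa [funext_iff, Pi.single_apply, eq_comm] using hcoeff

end Multinomial

lemma log_factorial_le (n : ℕ) :
    Real.log n.factorial ≤ n * Real.log n - n + Real.log n + 1 := by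
  rcases n with _ | n
  · simp
  have h := Stirling.log_stirlingSeq'_antitone (Nat.zero_le n)
  simp only [Function.comp_apply, Nat.succ_eq_add_one, Stirling.log_stirlingSeq_formula,
    zero_add, Nat.factorial_one, Nat.cast_one, Real.log_one, mul_one, one_div] at h
  rw [Real.log_mul two_ne_zero (by positivity), Real.log_div (by positivity) (by positivity),
    Real.log_inv, Real.log_exp] at h
  linarith [Real.log_natCast_nonneg (n + 1)]

lemma le_log_factorial (n : ℕ) : n * Real.log n - n ≤ Real.log n.factorial := by
  rcases eq_or_ne n 0 with rfl | hn
  · simp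
  have hlog_two_pi : 0 ≤ Real.log (2 * Real.pi) := Real.log_nonneg (by linarith [Real.two_le_pi])
  linarith [Stirling.le_log_factorial_stirling hn, Real.log_natCast_nonneg n]

lemma le_log_multinomial {A : Type*} (s : Finset A) (n : A → ℕ) :
    ∑ a ∈ s, n a * (Real.log ↑(∑ a ∈ s, n a) - Real.log (n a)) - ∑ a ∈ s, (Real.log (n a) + 1)
      ≤ Real.log (Nat.multinomial s n) := by
  have hspec : ∑ a ∈ s, Real.log (n a).factorial + Real.log (Nat.multinomial s n)
      = Real.log (∑ a ∈ s, n a).factorial := by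
    rw [← Real.log_prod fun a _ => by positivity, ← Nat.cast_prod, ← Real.log_mul
      (by exact_mod_cast (Finset.prod_pos fun a _ => (n a).factorial_pos).ne')
      (by exact_mod_cast (Nat.multinomial_pos s n).ne'), ← Nat.cast_mul, Nat.multinomial_spec]
  have hnum := le_log_factorial (∑ a ∈ s, n a)
  have hden := Finset.sum_le_sum fun a (_ : a ∈ s) => log_factorial_le (n a)
  simp only [Finset.sum_add_distrib, Finset.sum_sub_distrib, mul_sub, ← Finset.sum_mul,
    Nat.cast_sum] at *
  linarith

lemma exists_le_and_le_and_eq_of_finite_range {β : Type*} {d : ℕ → β} (hd : (Set.range d).Finite) :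
    ∃ M₀, ∀ M, ∃ M' ≤ M, M' ≤ M₀ ∧ d M' = d M := by
  obtain ⟨M₀, hM₀⟩ := (hd.image fun z => sInf {M | d M = z}).bddAbove
  exact ⟨M₀, fun M => ⟨sInf {M' | d M' = d M}, Nat.sInf_le rfl,
    hM₀ ⟨d M, ⟨M, rfl⟩, rfl⟩, Nat.sInf_mem (s := {M' | d M' = d M}) ⟨M, rfl⟩⟩⟩

section Rounding

variable {A ι : Type*} [Fintype A] [Finite ι]

lemma finite_range_sum_floor_smul {v : A → ι → ℤ} {p : A → ℝ} (hp : ∀ a, 0 ≤ p a)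
    (hv : ∀ i, ∑ a, p a * v a i = 0) :
    (Set.range fun M : ℕ => ∑ a, ⌊M * p a⌋₊ • v a).Finite := by
  refine (Set.Finite.pi' fun i => Set.finite_Icc (-∑ a, |v a i|) (∑ a, |v a i|)).subset ?_
  rintro _ ⟨M, rfl⟩ i
  rw [Set.mem_Icc, ← abs_le, ← Int.cast_le (R := ℝ)]
  have hround : ((∑ a, ⌊M * p a⌋₊ • v a) i : ℝ) = -∑ a, (M * p a - ⌊M * p a⌋₊) * v a i := by
    have : ∑ a, M * p a * v a i = 0 := by simp only [mul_assoc, ← Finset.mul_sum, hv, mul_zero]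
    simp [sub_mul, this]
  have hfloor (a : A) : |M * p a - ⌊M * p a⌋₊| ≤ 1 := abs_le.2
    ⟨by linarith [Nat.floor_le (mul_nonneg M.cast_nonneg (hp a))],
      by linarith [Nat.lt_floor_add_one (M * p a)]⟩
  push_cast
  rw [hround, abs_neg]
  refine (Finset.abs_sum_le_sum_abs _ _).trans (Finset.sum_le_sum fun a _ => ?_)
  rw [abs_mul]
  exact mul_le_of_le_one_left (abs_nonneg _) (hfloor a)

-- Rounding down `M * p` leaves a defect taking finitely many values; subtracting the rounding of
-- `M' * p` for a bounded `M'` with the same defect cancels it.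
lemma exists_sum_smul_eq_zero_below {v : A → ι → ℤ} {p : A → ℝ} (hp : p ∈ stdSimplex ℝ A)
    (hv : ∀ i, ∑ a, p a * v a i = 0) :
    ∃ c : ℝ, ∀ M : ℕ, ∃ k : A → ℕ,
      ∑ a, k a • v a = 0 ∧ ∀ a, k a ≤ M * p a ∧ M * p a - c ≤ k a := by
  obtain ⟨M₀, hM₀⟩ := exists_le_and_le_and_eq_of_finite_range (finite_range_sum_floor_smul hp.1 hv)
  refine ⟨M₀ + 1, fun M => ?_⟩
  obtain ⟨M', hM'M, hM'M₀, hdefect⟩ := hM₀ M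
  obtain ⟨k, hk⟩ : ∃ k : A → ℕ, (fun a => ⌊M * p a⌋₊) = (fun a => ⌊M' * p a⌋₊) + k :=
    exists_add_of_le fun a => Nat.floor_mono (by have := hp.1 a; gcongr)
  have hk_apply (a : A) : ⌊M * p a⌋₊ = ⌊M' * p a⌋₊ + k a := congrFun hk a
  refine ⟨k, ?_, fun a => ?_⟩
  · simpa only [hk_apply, add_smul, Finset.sum_add_distrib, left_eq_add] using hdefect
  have hM'p : (⌊M' * p a⌋₊ : ℝ) ≤ M₀ :=
    calc (⌊M' * p a⌋₊ : ℝ) ≤ M' * p a := Nat.floor_le (mul_nonneg M'.cast_nonneg (hp.1 a))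
      _ ≤ M' := mul_le_of_le_one_right M'.cast_nonneg
        (hp.2 ▸ Finset.single_le_sum (fun b _ => hp.1 b) (Finset.mem_univ a))
      _ ≤ M₀ := Nat.cast_le.2 hM'M₀
  have hk_cast : (⌊M * p a⌋₊ : ℝ) = ⌊M' * p a⌋₊ + k a := by exact_mod_cast hk_apply a
  constructor
  · linarith [Nat.floor_le (mul_nonneg M.cast_nonneg (hp.1 a)),
      (⌊M' * p a⌋₊).cast_nonneg (α := ℝ)]
  · linarith [Nat.lt_floor_add_one (M * p a)]

lemma exists_sum_eq_and_sum_smul_eq_zero_near {v : A → ι → ℤ} {a₀ : A} (ha₀ : v a₀ = 0)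
    {p : A → ℝ} (hp : p ∈ stdSimplex ℝ A) (hv : ∀ i, ∑ a, p a * v a i = 0) :
    ∃ c : ℝ, ∀ M : ℕ, ∃ n : A → ℕ,
      ∑ a, n a = M ∧ ∑ a, n a • v a = 0 ∧ ∀ a, |n a - M * p a| ≤ c := by
  classical
  obtain ⟨c, hc⟩ := exists_sum_smul_eq_zero_below hp hv
  refine ⟨Fintype.card A * c + c, fun M => ?_⟩
  obtain ⟨k, hk_zero, hk⟩ := hc M
  have hsum : ∑ a, M * p a = M := by rw [← Finset.mul_sum, hp.2, mul_one]
  have hsum_le : ∑ a, k a ≤ M := by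
    exact_mod_cast (Finset.sum_le_sum fun a _ => (hk a).1).trans hsum.le
  have hpad : ((M - ∑ a, k a : ℕ) : ℝ) ≤ Fintype.card A * c := by
    have := Finset.sum_le_sum fun a (_ : a ∈ Finset.univ) => (hk a).2
    rw [Finset.sum_sub_distrib, hsum, Finset.sum_const, Finset.card_univ, nsmul_eq_mul] at this
    push_cast [hsum_le]
    linarith
  refine ⟨k + Pi.single a₀ (M - ∑ a, k a), ?_, ?_, fun a => ?_⟩
  · simp [Finset.sum_add_distrib, hsum_le]
  · simp only [Pi.add_apply, add_smul, Finset.sum_add_distrib, hk_zero, zero_add]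
    exact Finset.sum_eq_zero fun a _ => by
      rcases eq_or_ne a a₀ with rfl | ha <;> simp [*]
  · have hsingle : (Pi.single a₀ (M - ∑ a, k a) : A → ℕ) a ≤ M - ∑ a, k a := by
      rcases eq_or_ne a a₀ with rfl | ha <;> simp [*]
    have hsingle_cast := (Nat.cast_le (α := ℝ).2 hsingle).trans hpad
    rw [Pi.add_apply, Nat.cast_add, abs_le]
    constructor <;> linarith [hk a, ((Pi.single a₀ (M - ∑ a, k a) : A → ℕ) a).cast_nonneg (α := ℝ)]

end Rounding

lemma mul_log_add_sub_le_mul_log {x y : ℝ} (hx : 0 < x) (hy : 0 ≤ y) :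
    y * Real.log x + y - x ≤ y * Real.log y := by
  rcases hy.eq_or_lt with rfl | hy
  · simpa using hx.le
  have h := mul_le_mul_of_nonneg_left (Real.log_le_sub_one_of_pos (div_pos hx hy)) hy.le
  rw [Real.log_div hx.ne' hy.ne', mul_sub_one, mul_div_cancel₀ _ hy.ne'] at h
  linarith

lemma mul_negMulLog_le {M n : ℕ} {p c : ℝ} (hM : 0 < M) (hn : n ≤ M) (hp : 0 ≤ p)
    (hc : |n - M * p| ≤ c) :
    M * p.negMulLog
      ≤ n * (Real.log M - Real.log n) + (c * (1 + Real.log M) + 1) := by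
  have hM_cast : (0 : ℝ) < M := Nat.cast_pos.2 hM
  have hscale : M * p.negMulLog = M * p * Real.log M - M * p * Real.log (M * p) := by
    rcases hp.eq_or_lt with rfl | hp
    · simp
    rw [Real.log_mul hM_cast.ne' hp.ne', Real.negMulLog]
    ring
  set x : ℝ := max n 1
  have hx : 1 ≤ x := le_max_right _ _
  have hn_log : (n : ℝ) * Real.log n = n * Real.log x := by
    rcases n.eq_zero_or_pos with rfl | hn
    · simp
    rw [show x = n from max_eq_left (Nat.one_le_cast.2 hn)]
  have htangent := mul_log_add_sub_le_mul_log (zero_lt_one.trans_le hx)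
    (mul_nonneg hM_cast.le hp)
  have hx_le : x ≤ n + 1 := max_le (by linarith) (by linarith [n.cast_nonneg (α := ℝ)])
  have hlog_x : 0 ≤ Real.log x := Real.log_nonneg hx
  have hlog_le : Real.log x ≤ Real.log M :=
    Real.log_le_log (by positivity) (max_le (Nat.cast_le.2 hn) (Nat.one_le_cast.2 hM))
  have hdiff : (M * p - n) * (Real.log M - Real.log x) ≤ c * Real.log M :=
    mul_le_mul (by linarith [neg_le_of_abs_le hc]) (by linarith) (by linarith)
      ((abs_nonneg _).trans hc)
  linarith [le_of_abs_le hc]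

section Words

variable {A ι : Type*} [Fintype A] [Fintype ι]

lemma multinomial_le_card_filter_sum_eq_zero {X : Type*} [Fintype X] [DecidableEq X]
    {v : A → ι → ℤ} {n : A → ℕ} (hn : ∑ a, n a = Fintype.card X) (hv : ∑ a, n a • v a = 0) :
    Nat.multinomial Finset.univ n ≤ #{f : X → A | ∑ x, v (f x) = 0} := by
  classical
  rw [← card_filter_fiber_card_eq_multinomial hn]
  refine Finset.card_le_card (Finset.monotone_filter_right _ fun f _ hf => ?_)
  rw [← hv, ← Finset.sum_fiberwise Finset.univ f]
  refine Finset.sum_congr rfl fun a _ => ?_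
  rw [← hf a, ← Finset.sum_const]
  exact Finset.sum_congr rfl fun x hx => by rw [(Finset.mem_filter.1 hx).2]

lemma exists_le_log_card_filter_sum_eq_zero {v : A → ι → ℤ} {a₀ : A} (ha₀ : v a₀ = 0) {L : ℝ}
    (hL : ∀ u : ι → ℝ, L ≤ Real.log (∑ a, Real.exp (u ⬝ᵥ fun i => v a i))) :
    ∃ c : ℝ, ∀ M : ℕ, 0 < M →
      M * L - c * (1 + Real.log M) ≤ Real.log #{f : Fin M → A | ∑ x, v (f x) = 0} := by
  classical
  have : Nonempty A := ⟨a₀⟩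
  obtain ⟨p, hp, hpL, hpv⟩ := exists_mem_stdSimplex_le_sum_negMulLog (fun a i => (v a i : ℝ)) hL
  obtain ⟨c, hc⟩ := exists_sum_eq_and_sum_smul_eq_zero_near ha₀ hp fun i => by
    simpa using congrFun hpv i
  refine ⟨Fintype.card A * (c + 2), fun M hM => ?_⟩
  obtain ⟨n, rfl, hn, hnp⟩ := hc M
  set M := ∑ a, n a
  have hlog_M : 0 ≤ Real.log M := Real.log_natCast_nonneg M
  have hterm (a : A) : M * (p a).negMulLog - (c + 2) * (1 + Real.log M)
      ≤ n a * (Real.log M - Real.log (n a)) - (Real.log (n a) + 1) := by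
    have hle : n a ≤ M := Finset.single_le_sum (fun b _ => (n b).zero_le) (Finset.mem_univ a)
    have hlog_le : Real.log (n a) ≤ Real.log M := by
      rcases (n a).eq_zero_or_pos with h | h
      · simpa [h] using hlog_M
      · gcongr
    linarith [mul_negMulLog_le hM hle (hp.1 a) (hnp a)]
  calc M * L - Fintype.card A * (c + 2) * (1 + Real.log M)
      ≤ M * ∑ a, (p a).negMulLog - Fintype.card A * (c + 2) * (1 + Real.log M) := by gcongr
    _ = ∑ a, (M * (p a).negMulLog - (c + 2) * (1 + Real.log M)) := by
      rw [Finset.sum_sub_distrib, ← Finset.mul_sum, Finset.sum_const, Finset.card_univ,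
        nsmul_eq_mul, mul_assoc]
    _ ≤ ∑ a, (n a * (Real.log M - Real.log (n a)) - (Real.log (n a) + 1)) :=
      Finset.sum_le_sum fun a _ => hterm a
    _ ≤ Real.log (Nat.multinomial Finset.univ n) := by
      rw [Finset.sum_sub_distrib]
      exact le_log_multinomial Finset.univ n
    _ ≤ Real.log #{f : Fin M → A | ∑ x, v (f x) = 0} := by
      gcongr
      · exact Nat.cast_pos.2 (Nat.multinomial_pos _ _)
      · exact multinomial_le_card_filter_sum_eq_zero (Fintype.card_fin M).symm hn

end Words

/-! ### Tables and their clones -/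

section Tables

variable {ι κ : Type*} [Fintype ι] [Fintype κ] (K : Matrix ι κ ℕ) (R : ι → ℕ) (C : κ → ℕ)

/-- The row and column sums of a `K`-bounded table minus the prescribed ones, so that the tables
with margins `R`, `C` are those of margin defect `0`. -/
def marginDefect (A : ∀ i j, Fin (K i j + 1)) : ι ⊕ κ → ℤ :=
  Sum.elim (fun i => ∑ j, (A i j : ℤ) - R i) (fun j => ∑ i, (A i j : ℤ) - C j)

variable {K R C} in
lemma sum_marginDefect_eq_zero_iff {X : Type*} [Fintype X] {f : X → ∀ i j, Fin (K i j + 1)} :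
    ∑ x, marginDefect K R C (f x) = 0 ↔
      (∀ i, ∑ x, ∑ j, (f x i j : ℕ) = Fintype.card X * R i) ∧
        ∀ j, ∑ x, ∑ i, (f x i j : ℕ) = Fintype.card X * C j := by
  simp only [funext_iff, Finset.sum_apply, Pi.zero_apply, Sum.forall, marginDefect, Sum.elim_inl,
    Sum.elim_inr, Finset.sum_sub_distrib, Finset.sum_const, Finset.card_univ, nsmul_eq_mul,
    sub_eq_zero]
  norm_cast

variable {K R C} in
lemma marginDefect_eq_zero_iff {A : ∀ i j, Fin (K i j + 1)} :
    marginDefect K R C A = 0 ↔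
      (∀ i, ∑ j, (A i j : ℕ) = R i) ∧ ∀ j, ∑ i, (A i j : ℕ) = C j := by
  simpa using sum_marginDefect_eq_zero_iff (X := Unit) (f := fun _ => A)

lemma boundedTables_eq_image :
    boundedTables K R C = (fun A i j => (A i j : ℕ)) '' {A | marginDefect K R C A = 0} := by
  ext B
  constructor
  · rintro ⟨hR, hC, hK⟩
    exact ⟨fun i j => ⟨B i j, Nat.lt_succ_of_le (hK i j)⟩, marginDefect_eq_zero_iff.2 ⟨hR, hC⟩, rfl⟩
  · rintro ⟨A, hA, rfl⟩
    obtain ⟨hR, hC⟩ := marginDefect_eq_zero_iff.1 hA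
    exact ⟨hR, hC, fun i j => Nat.le_of_lt_succ (A i j).2⟩

lemma finite_boundedTables : (boundedTables K R C).Finite := by
  classical
  exact boundedTables_eq_image K R C ▸ (Set.toFinite _).image _

lemma tableCount_submatrix {ι' κ' : Type*} [Fintype ι'] [Fintype κ'] (e : ι' ≃ ι) (f : κ' ≃ κ) :
    tableCount (K.submatrix e f) (R ∘ e) (C ∘ f) = tableCount K R C := by
  refine Set.ncard_congr (fun A _ => A.submatrix e.symm f.symm) ?_ ?_ ?_
  · rintro A ⟨hR, hC, hK⟩
    exact ⟨fun i => by simpa [f.symm.sum_comp (A (e.symm i))] using hR (e.symm i),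
      fun j => by simpa [e.symm.sum_comp (A · (f.symm j))] using hC (f.symm j),
      fun i j => by simpa using hK (e.symm i) (f.symm j)⟩
  · exact fun A B _ _ h => (Matrix.reindex e f).injective h
  · rintro A ⟨hR, hC, hK⟩
    exact ⟨A.submatrix e f, ⟨fun i => by simpa [f.sum_comp (A (e i))] using hR (e i),
      fun j => by simpa [e.sum_comp (A · (f j))] using hC (f j), fun i j => hK _ _⟩, by simp⟩

section GeneratingFunction

variable [DecidableEq ι] [DecidableEq κ]

lemma tableCount_eq_card_filter :
    tableCount K R C = #{A | marginDefect K R C A = 0} := by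
  rw [tableCount, boundedTables_eq_image, ← Set.ncard_coe_finset, Finset.coe_filter_univ]
  exact Set.ncard_image_of_injective _ fun A B h => by
    funext i j
    exact Fin.ext (congrFun (congrFun h i) j)

lemma tableGenFun_eq_sum (x : ι → ℝ) (y : κ → ℝ) :
    tableGenFun K x y = ∑ A : ∀ i j, Fin (K i j + 1),
      (∏ i, x i ^ ∑ j, (A i j : ℕ)) * ∏ j, y j ^ ∑ i, (A i j : ℕ) := by
  have hrow (i : ι) : ∏ j, ∑ t ∈ Finset.range (K i j + 1), (x i * y j) ^ t
      = ∑ a : ∀ j, Fin (K i j + 1), ∏ j, (x i * y j) ^ (a j : ℕ) := by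
    simp only [Finset.sum_range]
    rw [Finset.prod_univ_sum, Fintype.piFinset_univ]
  simp only [tableGenFun, hrow]
  rw [Finset.prod_univ_sum, Fintype.piFinset_univ]
  refine Finset.sum_congr rfl fun A _ => ?_
  simp only [mul_pow, Finset.prod_mul_distrib, Finset.prod_pow_eq_pow_sum]
  congr 1
  rw [Finset.prod_comm]
  simp only [Finset.prod_pow_eq_pow_sum]

lemma tableGenFun_exp_div_eq_sum (u : ι ⊕ κ → ℝ) :
    tableGenFun K (fun i => Real.exp (u (.inl i))) (fun j => Real.exp (u (.inr j))) /
        ((∏ i, Real.exp (u (.inl i)) ^ R i) * ∏ j, Real.exp (u (.inr j)) ^ C j)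
      = ∑ A, Real.exp (u ⬝ᵥ fun i => marginDefect K R C A i) := by
  rw [tableGenFun_eq_sum, Finset.sum_div]
  refine Finset.sum_congr rfl fun A _ => ?_
  simp only [← Real.exp_nat_mul, ← Real.exp_sum, ← Real.exp_add, ← Real.exp_sub, dotProduct,
    Fintype.sum_sum_type, marginDefect, Sum.elim_inl, Sum.elim_inr]
  push_cast
  simp only [mul_comm (u _), sub_mul, Finset.sum_sub_distrib]
  rw [add_sub_add_comm]

lemma genFunInf_eq_iInf :
    genFunInf K R C = ⨅ u : ι ⊕ κ → ℝ, ∑ A, Real.exp (u ⬝ᵥ fun i => marginDefect K R C A i) := by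
  simp only [genFunInf, iInf, ← tableGenFun_exp_div_eq_sum]
  congr 1
  ext v
  constructor
  · rintro ⟨x, y, hx, hy, rfl⟩
    exact ⟨Sum.elim (fun i => Real.log (x i)) (fun j => Real.log (y j)), by
      simp only [Sum.elim_inl, Sum.elim_inr, Real.exp_log (hx _), Real.exp_log (hy _)]⟩
  · rintro ⟨u, rfl⟩
    exact ⟨_, _, fun i => Real.exp_pos _, fun j => Real.exp_pos _, rfl⟩

lemma genFunInf_le_sum_exp (u : ι ⊕ κ → ℝ) :
    genFunInf K R C ≤ ∑ A, Real.exp (u ⬝ᵥ fun i => marginDefect K R C A i) := by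
  rw [genFunInf_eq_iInf]
  exact ciInf_le ⟨0, by rintro _ ⟨u, rfl⟩; positivity⟩ u

end GeneratingFunction

lemma tableCount_le_genFunInf : tableCount K R C ≤ genFunInf K R C := by
  classical
  rw [genFunInf_eq_iInf, tableCount_eq_card_filter]
  refine le_ciInf fun u => ?_
  calc (#{A | marginDefect K R C A = 0} : ℝ)
      = ∑ A with marginDefect K R C A = 0, Real.exp (u ⬝ᵥ fun i => marginDefect K R C A i) := by
        rw [← nsmul_one, ← Finset.sum_const]
        refine Finset.sum_congr rfl fun A hA => ?_
        simp [(Finset.mem_filter.1 hA).2, ← Pi.zero_def]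
    _ ≤ ∑ A, Real.exp (u ⬝ᵥ fun i => marginDefect K R C A i) :=
        Finset.sum_le_univ_sum_of_nonneg fun A => (Real.exp_pos _).le

end Tables

section Clones

variable {ι κ : Type*} [Fintype ι] [Fintype κ] {K : Matrix ι κ ℕ} {R : ι → ℕ} {C : κ → ℕ} {s : ℕ}

variable (K R C s) in
/-- `T_{K^{(s)}}(R^{(s)}, C^{(s)})` for margins indexed by arbitrary finite types; the rows of the
`s × s` block matrix are indexed by pairs (block, row inside the block), and likewise for the
columns. -/
noncomputable def cloneCount : ℕ :=
  tableCount (K.submatrix Prod.snd Prod.snd : Matrix (Fin s × ι) (Fin s × κ) ℕ)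
    (fun a => s * R a.2) (fun b => s * C b.2)

lemma tableCount_clone {m n : ℕ} (s : ℕ) (R : Fin m → ℕ) (C : Fin n → ℕ)
    (K : Matrix (Fin m) (Fin n) ℕ) :
    tableCount (cloneMatrix s K) (cloneMargin s R) (cloneMargin s C) = cloneCount K R C s :=
  tableCount_submatrix (K.submatrix Prod.snd Prod.snd) (fun a : Fin s × Fin m => s * R a.2)
    (fun b : Fin s × Fin n => s * C b.2) finProdFinEquiv.symm finProdFinEquiv.symm

lemma cloneCount_pos (hT : 0 < tableCount K R C) : 0 < cloneCount K R C s := by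
  obtain ⟨A, hR, hC, hK⟩ := (Set.ncard_pos (finite_boundedTables K R C)).1 hT
  refine (Set.ncard_pos (finite_boundedTables _ _ _)).2
    ⟨A.submatrix Prod.snd Prod.snd, fun a => ?_, fun b => ?_, fun a b => hK _ _⟩ <;>
  simp [Fintype.sum_prod_type, hR, hC]

lemma genFunInf_clone_le [DecidableEq ι] [DecidableEq κ] (u : ι ⊕ κ → ℝ) :
    genFunInf (K.submatrix Prod.snd Prod.snd : Matrix (Fin s × ι) (Fin s × κ) ℕ)
        (fun a => s * R a.2) (fun b => s * C b.2)
      ≤ (∑ A, Real.exp (u ⬝ᵥ fun i => marginDefect K R C A i)) ^ (s * s) := by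
  refine (genFunInf_le_sum_exp _ _ _ (Sum.elim (fun a => u (.inl a.2)) fun b => u (.inr b.2))).trans
    (le_of_eq ?_)
  rw [← tableGenFun_exp_div_eq_sum, ← tableGenFun_exp_div_eq_sum, div_pow, mul_pow]
  simp only [tableGenFun, Matrix.submatrix_apply, Sum.elim_inl, Sum.elim_inr,
    Fintype.prod_prod_type, Finset.prod_const, Finset.card_univ, Fintype.card_fin,
    mul_comm s (_ : ℕ), pow_mul, Finset.prod_pow]

lemma log_cloneCount_le (hs : 0 < s) (hT : 0 < tableCount K R C) :
    Real.log (cloneCount K R C s) ≤ s ^ 2 * Real.log (genFunInf K R C) := by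
  classical
  have hs_sq : (0 : ℝ) < s ^ 2 := by positivity
  have hcount : (0 : ℝ) < cloneCount K R C s := Nat.cast_pos.2 (cloneCount_pos hT)
  have hinf : 0 < genFunInf K R C := (Nat.cast_pos.2 hT).trans_le (tableCount_le_genFunInf K R C)
  rw [← div_le_iff₀' hs_sq, Real.le_log_iff_exp_le hinf, genFunInf_eq_iInf]
  refine le_ciInf fun u => ?_
  have hsum := hinf.trans_le (genFunInf_le_sum_exp K R C u)
  rw [← Real.le_log_iff_exp_le hsum, div_le_iff₀' hs_sq]
  have hle := Real.log_le_log hcount ((tableCount_le_genFunInf _ _ _).trans (genFunInf_clone_le u))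
  rwa [Real.log_pow, ← sq, Nat.cast_pow] at hle

lemma sum_filter_snd_eq (D : Fin s × κ → ℕ) [DecidableEq κ] (j : κ) :
    ∑ b with b.2 = j, D b = ∑ b, D (b, j) := by
  rw [Finset.sum_filter, Fintype.sum_prod_type]
  simp

lemma tableCount_le_cloneCount {D : Fin s × κ → ℕ} (hD : ∀ j, ∑ b, D (b, j) = s * (s * C j)) :
    tableCount (K.submatrix Prod.snd Prod.snd) (fun a : Fin s × ι => s * R a.2) D
      ≤ cloneCount K R C s := by
  classical
  refine tableCount_le_of_const_on_fibers Prod.snd _ _ (fun j₁ j₂ h i => ?_) (fun j₁ j₂ h => ?_) D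
    fun j => ?_
  · simp only [Matrix.submatrix_apply, h]
  · simp only [h]
  · refine (sum_filter_snd_eq D j).trans (((hD j).trans ?_).trans (sum_filter_snd_eq _ j).symm)
    simp

/-- The block matrix whose block in position `(a, b)` is the `K`-bounded table `F a b`. -/
def blockTable (F : Fin s → Fin s → ∀ i j, Fin (K i j + 1)) :
    Matrix (Fin s × ι) (Fin s × κ) ℕ :=
  fun a b => F a.1 b.1 a.2 b.2

section Words

variable [DecidableEq ι] [DecidableEq κ]

lemma card_filter_colSum_blockTable_eq_le (D : Fin s × κ → ℕ) :
    #{F ∈ Fintype.piFinset fun _ : Fin s =>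
        ({f | ∑ b, marginDefect K R C (f b) = 0} : Finset (Fin s → ∀ i j, Fin (K i j + 1))) |
      (fun b => ∑ a, blockTable F a b) = D}
      ≤ tableCount (K.submatrix Prod.snd Prod.snd) (fun a : Fin s × ι => s * R a.2) D := by
  rw [← Set.ncard_coe_finset]
  refine Set.ncard_le_ncard_of_injOn blockTable (fun F hF => ?_) (fun F _ G _ h => ?_)
    (finite_boundedTables _ _ _)
  · simp only [Finset.coe_filter, Fintype.mem_piFinset, Finset.mem_filter_univ,
      sum_marginDefect_eq_zero_iff, Fintype.card_fin, Set.mem_ofPred_eq] at hF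
    refine ⟨fun a => ?_, congrFun hF.2, fun a b => Nat.le_of_lt_succ (F _ _ _ _).2⟩
    rw [Fintype.sum_prod_type]
    exact (hF.1 a.1).1 a.2
  · funext a b i j
    exact Fin.ext (congrFun (congrFun h (a, i)) (b, j))

-- The rows of blocks are chosen independently, each with exact margins; then the row sums of the
-- block matrix are right, and only its column sums still vary.
lemma card_filter_sum_marginDefect_pow_le :
    #{f : Fin s → ∀ i j, Fin (K i j + 1) | ∑ b, marginDefect K R C (f b) = 0} ^ s
      ≤ cloneCount K R C s * (∏ j, (s * (s * C j) + 1)) ^ s := by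
  set W : Finset (Fin s → ∀ i j, Fin (K i j + 1)) := {f | ∑ b, marginDefect K R C (f b) = 0}
  have hcol {F : Fin s → Fin s → ∀ i j, Fin (K i j + 1)} (hF : ∀ a, F a ∈ W) (j : κ) :
      ∑ b, ∑ a, blockTable F a (b, j) = s * (s * C j) := by
    have hrow (a : Fin s) : ∑ b, ∑ i, (F a b i j : ℕ) = s * C j := by
      have hFa : ∑ b, marginDefect K R C (F a b) = 0 := by
        simpa only [W, Finset.mem_filter_univ] using hF a
      simpa using (sum_marginDefect_eq_zero_iff.1 hFa).2 j
    simp only [Fintype.sum_prod_type, blockTable]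
    rw [Finset.sum_comm]
    simp [hrow]
  calc #W ^ s = #(Fintype.piFinset fun _ : Fin s => W) := by simp
    _ ≤ cloneCount K R C s *
        #(Fintype.piFinset fun b : Fin s × κ => Finset.range (s * (s * C b.2) + 1)) := by
      refine Finset.card_le_mul_card_image_of_maps_to
        (f := fun F b => ∑ a, blockTable F a b) (fun F hF => ?_) _ fun D _ => ?_
      · refine Fintype.mem_piFinset.2 fun b => Finset.mem_range_succ_iff.2 ?_
        rw [← hcol (Fintype.mem_piFinset.1 hF) b.2]
        exact Finset.single_le_sum (f := fun b' => ∑ a, blockTable F a (b', b.2))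
          (fun _ _ => Nat.zero_le _) (Finset.mem_univ b.1)
      · rcases Finset.eq_empty_or_nonempty
          {F ∈ Fintype.piFinset fun _ : Fin s => W | (fun b => ∑ a, blockTable F a b) = D}
          with hempty | ⟨F, hF⟩
        · simp [hempty]
        obtain ⟨hFW, rfl⟩ := Finset.mem_filter.1 hF
        exact (card_filter_colSum_blockTable_eq_le _).trans
          (tableCount_le_cloneCount (hcol (Fintype.mem_piFinset.1 hFW)))
    _ = cloneCount K R C s * (∏ j, (s * (s * C j) + 1)) ^ s := by
      simp [Fintype.card_piFinset, Fintype.prod_prod_type]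

end Words

lemma log_sq_mul_add_one_le (hs : 0 < s) (c : ℕ) :
    Real.log ↑(s * (s * c) + 1) ≤ (2 + Real.log (c + 1)) * (1 + Real.log s) := by
  have hs_one : (1 : ℝ) ≤ s := Nat.one_le_cast.2 hs
  have hlog_s : 0 ≤ Real.log s := Real.log_nonneg hs_one
  have hlog_c : 0 ≤ Real.log ((c : ℝ) + 1) :=
    Real.log_nonneg (by linarith [c.cast_nonneg (α := ℝ)])
  calc Real.log ↑(s * (s * c) + 1) ≤ Real.log ((s : ℝ) ^ 2 * (c + 1)) := by
        push_cast
        gcongr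
        nlinarith
    _ = 2 * Real.log s + Real.log (c + 1) := by
        rw [Real.log_mul (by positivity) (by positivity), Real.log_pow, Nat.cast_two]
    _ ≤ (2 + Real.log (c + 1)) * (1 + Real.log s) := by nlinarith

lemma exists_le_log_cloneCount (hT : 0 < tableCount K R C) :
    ∃ c : ℝ, ∀ s : ℕ, 0 < s →
      s ^ 2 * Real.log (genFunInf K R C) - c * (s * (1 + Real.log s))
        ≤ Real.log (cloneCount K R C s) := by
  classical
  obtain ⟨A₀, hA₀⟩ : ∃ A₀, marginDefect K R C A₀ = 0 := by
    simpa [tableCount_eq_card_filter, Finset.card_pos, Finset.filter_nonempty_iff] using hT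
  have hinf : 0 < genFunInf K R C := (Nat.cast_pos.2 hT).trans_le (tableCount_le_genFunInf K R C)
  obtain ⟨c, hc⟩ := exists_le_log_card_filter_sum_eq_zero hA₀ fun u =>
    Real.log_le_log hinf (genFunInf_le_sum_exp K R C u)
  refine ⟨c + ∑ j, (2 + Real.log (C j + 1)), fun s hs => ?_⟩
  set W : Finset (Fin s → ∀ i j, Fin (K i j + 1)) := {f | ∑ b, marginDefect K R C (f b) = 0}
  have hW : 0 < #W := Finset.card_pos.2 ⟨fun _ => A₀, by simp [W, hA₀]⟩
  have hcount : s * Real.log #W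
      ≤ Real.log (cloneCount K R C s) + s * ∑ j, Real.log ↑(s * (s * C j) + 1) := by
    have h := Real.log_le_log (by positivity)
      (Nat.cast_le (α := ℝ).2 (card_filter_sum_marginDefect_pow_le (K := K) (R := R) (C := C)))
    rwa [Nat.cast_mul, Nat.cast_pow, Nat.cast_pow, Nat.cast_prod, Real.log_pow, Real.log_mul
      (Nat.cast_pos.2 (cloneCount_pos hT)).ne' (by positivity), Real.log_pow,
      Real.log_prod fun j _ => by positivity] at h
  have hmargins : ∑ j, Real.log ↑(s * (s * C j) + 1)
      ≤ (∑ j, (2 + Real.log (C j + 1))) * (1 + Real.log s) := by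
    rw [Finset.sum_mul]
    exact Finset.sum_le_sum fun j _ => log_sq_mul_add_one_le hs (C j)
  have hs_nonneg : (0 : ℝ) ≤ s := s.cast_nonneg
  linarith [mul_le_mul_of_nonneg_left (hc s hs) hs_nonneg,
    mul_le_mul_of_nonneg_left hmargins hs_nonneg]

lemma isBigO_log_cloneCount (hT : 0 < tableCount K R C) :
    (fun s : ℕ => 1 / (s : ℝ) ^ 2 * Real.log (cloneCount K R C s) - Real.log (genFunInf K R C))
      =O[atTop] fun s : ℕ => Real.log s / s := by
  obtain ⟨c, hc⟩ := exists_le_log_cloneCount hT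
  refine IsBigO.of_bound (2 * |c|) ?_
  filter_upwards [eventually_ge_atTop 3] with s hs
  have hs_pos : (0 : ℝ) < s := by positivity
  have hlog : 1 ≤ Real.log s := by
    rw [Real.le_log_iff_exp_le hs_pos]
    exact Real.exp_one_lt_three.le.trans (by exact_mod_cast hs)
  have hupper := log_cloneCount_le (show 0 < s by omega) hT
  have hlower := hc s (by omega)
  set T := Real.log (cloneCount K R C s)
  set L := Real.log (genFunInf K R C)
  have herror : |T - s ^ 2 * L| ≤ 2 * |c| * (s * Real.log s) := by
    have : c * (s * (1 + Real.log s)) ≤ |c| * (s * (2 * Real.log s)) :=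
      mul_le_mul (le_abs_self c) (by gcongr; linarith) (by positivity) (abs_nonneg c)
    rw [abs_of_nonpos (by linarith)]
    linarith
  rw [Real.norm_eq_abs, Real.norm_of_nonneg (by positivity),
    show 1 / (s : ℝ) ^ 2 * T - L = (T - s ^ 2 * L) / s ^ 2 by field_simp, abs_div,
    abs_of_pos (by positivity : (0 : ℝ) < s ^ 2), div_le_iff₀ (by positivity)]
  exact herror.trans_eq (by field_simp)

end Clones

theorem theorem2_general {ι κ : Type*} [Fintype ι] [Fintype κ] (R : ι → ℕ) (C : κ → ℕ)
    (K : Matrix ι κ ℕ) (hT : 0 < tableCount K R C) :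
    (∀ s : ℕ, 0 < cloneCount K R C s) ∧
    0 < genFunInf K R C ∧
    Tendsto (fun s : ℕ => 1 / (s : ℝ) ^ 2 * Real.log (cloneCount K R C s))
      atTop (𝓝 (Real.log (genFunInf K R C))) ∧
    (fun s : ℕ => 1 / (s : ℝ) ^ 2 * Real.log (cloneCount K R C s) - Real.log (genFunInf K R C))
      =O[atTop] (fun s : ℕ => Real.log s / s) := by
  have hlog_div : Tendsto (fun s : ℕ => Real.log s / s) atTop (𝓝 0) :=
    Real.isLittleO_log_id_atTop.tendsto_div_nhds_zero.comp tendsto_natCast_atTop_atTop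
  exact ⟨fun s => cloneCount_pos hT, (Nat.cast_pos.2 hT).trans_le (tableCount_le_genFunInf K R C),
    tendsto_sub_nhds_zero_iff.1 ((isBigO_log_cloneCount hT).trans_tendsto hlog_div),
    isBigO_log_cloneCount hT⟩

theorem theorem2 {m n : ℕ} (R : Fin m → ℕ) (C : Fin n → ℕ) (K : Matrix (Fin m) (Fin n) ℕ)
    (hR : ∀ i, 0 < R i) (hC : ∀ j, 0 < C j) (hK : ∀ i j, 0 < K i j)
    (hT : 0 < tableCount K R C) :
    (∀ s : ℕ, 0 < tableCount (cloneMatrix s K) (cloneMargin s R) (cloneMargin s C)) ∧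
    0 < genFunInf K R C ∧
    Tendsto
      (fun s : ℕ => 1 / (s : ℝ) ^ 2 *
        Real.log (tableCount (cloneMatrix s K) (cloneMargin s R) (cloneMargin s C)))
      atTop (𝓝 (Real.log (genFunInf K R C))) ∧
    (fun s : ℕ => 1 / (s : ℝ) ^ 2 *
        Real.log (tableCount (cloneMatrix s K) (cloneMargin s R) (cloneMargin s C))
        - Real.log (genFunInf K R C))
      =O[atTop] (fun s : ℕ => Real.log s / s) := by
  simpa only [tableCount_clone] using theorem2_general R C K hT
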